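/- Let $\Phi$ be a complete, reflexive countably normed space over $\mathbb C$: its topology is the locally convex topology defined by a non-decreasing sequence of norms $(\|\cdot\|_p)_{p\in\mathbb N}$ that are pairwise compatible (if a sequence is Cauchy for $\|\cdot\|_p$ and for $\|\cdot\|_q$ and tends to $0$ for one of them, then it tends to $0$ for the other), $\Phi$ is complete, and the canonical map of $\Phi$ into its strong bidual is bijective and a homeomorphism. Let $\Phi_p$ be the completion of $\Phi$ with respect to $\|\cdot\|_p$, let $\Phi_p'$ be its dual Banach space, with the dual norm again denoted $\|\cdot\|_p$, and regard $\Phi_p'$ as a subspace of $\Phi'$ by restricting functionals to $\Phi$, so that $\Phi'=\bigcup_p\Phi_p'$. Let $\mathcal A=\Phi'$ be endowed with the strong topology (uniform convergence on the bounded subsets of $\Phi$), and let $\mathcal A\times\mathcal A\to\mathcal A$, $(a,b)\mapsto ab$, be an associative (not necessarily unital) $\mathbb C$-bilinear multiplication making $\mathcal A$ a strong algebra, that is: there is a constant $d\in\mathbb N$ such that for every $q$ and every $p>q+d$ there is a constant $A_{p,q}>0$ such that, for all $a\in\Phi_q'$ and $b\in\Phi_p'$, one has $ab,ba\in\Phi_p'$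 and $$\|ab\|_p\le A_{p,q}\|a\|_q\|b\|_p\quad\text{and}\quad \|ba\|_p\le A_{p,q}\|a\|_q\|b\|_p .$$ **Theorem 2.2.** The multiplication $\mathcal A\times\mathcal A\to\mathcal A$ is (jointly) continuous in the strong topology. Hence $(\mathcal A,+,\cdot)$ is a topological $\mathbb C$-algebra: addition, negation, multiplication $\mathcal A\times\mathcal A\to\mathcal A$ and scalar multiplication $\mathbb C\times\mathcal A\to\mathcal A$ are all continuous. -/

import Mathlib

open Topology Filter

noncomputable section

section CountablyNormed

/-- `IsCountablyNormed n`: the complex vector space `E` with its topology is a countably normed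
space, with the non-decreasing sequence `n` of pairwise compatible norms as defining norms. -/
structure IsCountablyNormed {E : Type*} [AddCommGroup E] [Module ℂ E] [TopologicalSpace E]
    (n : ℕ → Seminorm ℂ E) : Prop where
  /-- Every `n p` is a norm. -/
  eq_zero : ∀ (p : ℕ) (x : E), n p x = 0 → x = 0
  /-- The norms are non-decreasing. -/
  mono : ∀ p q : ℕ, p ≤ q → n p ≤ n q
  /-- A sequence that is Cauchy for two of the norms and tends to zero for one of them tends to
  zero for the other. -/
  compatible : ∀ (p q : ℕ) (x : ℕ → E),
    (∀ ε > 0, ∃ N, ∀ i ≥ N, ∀ j ≥ N, n p (x i - x j) < ε) →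
    (∀ ε > 0, ∃ N, ∀ i ≥ N, ∀ j ≥ N, n q (x i - x j) < ε) →
    Tendsto (fun k => n p (x k)) atTop (𝓝 0) → Tendsto (fun k => n q (x k)) atTop (𝓝 0)
  /-- The topology of `E` is the locally convex topology defined by the norms. -/
  withSeminorms : WithSeminorms n

/-- The vector space `E`, carrying the single (semi)norm `N` instead of its own topology. -/
def Renormed {E : Type*} [AddCommGroup E] [Module ℂ E] (_N : Seminorm ℂ E) : Type _ := E

instance Renormed.instSeminormedAddCommGroup {E : Type*} [AddCommGroup E] [Module ℂ E]
    (N : Seminorm ℂ E) : SeminormedAddCommGroup (Renormed N) :=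
  AddGroupSeminorm.toSeminormedAddCommGroup (E := E) N.toAddGroupSeminorm

instance Renormed.instModule {E : Type*} [AddCommGroup E] [Module ℂ E]
    (N : Seminorm ℂ E) : Module ℂ (Renormed N) :=
  inferInstanceAs (Module ℂ E)

instance Renormed.instNormedSpace {E : Type*} [AddCommGroup E] [Module ℂ E]
    (N : Seminorm ℂ E) : NormedSpace ℂ (Renormed N) where
  norm_smul_le c x := (map_smul_eq_mul N c x).le

/-- The Banach space obtained by completing `E` with respect to `N`. -/
abbrev NormCompletion {E : Type*} [AddCommGroup E] [Module ℂ E] (N : Seminorm ℂ E) : Type _ :=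
  UniformSpace.Completion (Renormed N)

/-- The canonical map of `E` into its completion with respect to `N`. -/
def toNormCompletion {E : Type*} [AddCommGroup E] [Module ℂ E] (N : Seminorm ℂ E) :
    E →ₗ[ℂ] NormCompletion N where
  toFun x := ((show Renormed N from x : Renormed N) : NormCompletion N)
  map_add' x y := UniformSpace.Completion.coe_add (α := Renormed N) x y
  map_smul' c x := UniformSpace.Completion.coe_smul (X := Renormed N) c x

theorem norm_toNormCompletion {E : Type*} [AddCommGroup E] [Module ℂ E] (N : Seminorm ℂ E)
    (x : E) : ‖toNormCompletion N x‖ = N x :=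
  UniformSpace.Completion.norm_coe (E := Renormed N) x

theorem IsCountablyNormed.continuous_toNormCompletion {E : Type*} [AddCommGroup E] [Module ℂ E]
    [TopologicalSpace E] [IsTopologicalAddGroup E] {n : ℕ → Seminorm ℂ E}
    (hn : IsCountablyNormed n) (p : ℕ) : Continuous (toNormCompletion (n p)) := by
  refine continuous_of_continuousAt_zero (toNormCompletion (n p)).toAddMonoidHom ?_
  have h : Tendsto (n p) (𝓝 0) (𝓝 (n p 0)) := (hn.withSeminorms.continuous_seminorm p).tendsto 0
  rw [map_zero] at h
  change Tendsto (toNormCompletion (n p)) (𝓝 0) (𝓝 (toNormCompletion (n p) 0))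
  rw [map_zero, tendsto_zero_iff_norm_tendsto_zero]
  simpa only [norm_toNormCompletion] using h

/-- The inclusion into the dual of `E` of the dual of the completion of `E` for the `p`-th norm:
a bounded functional on the completion is restricted to `E`. The domain carries the dual norm. -/
def IsCountablyNormed.dualInclusion {E : Type*} [AddCommGroup E] [Module ℂ E]
    [TopologicalSpace E] [IsTopologicalAddGroup E] {n : ℕ → Seminorm ℂ E}
    (hn : IsCountablyNormed n) (p : ℕ) :
    StrongDual ℂ (NormCompletion (n p)) →ₗ[ℂ] StrongDual ℂ E where
  toFun f := f.comp ⟨toNormCompletion (n p), hn.continuous_toNormCompletion p⟩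
  map_add' _ _ := rfl
  map_smul' _ _ := rfl

end CountablyNormed

section Reflexive

/-- The canonical map of `E` into its strong bidual, `x ↦ (f ↦ f x)`. -/
def strongBidualMap (E : Type*) [AddCommGroup E] [Module ℂ E] [TopologicalSpace E]
    [ContinuousSMul ℂ E] : E →ₗ[ℂ] StrongDual ℂ (StrongDual ℂ E) where
  toFun x :=
    { toFun := fun f => f x
      map_add' := fun _ _ => rfl
      map_smul' := fun _ _ => rfl
      cont := continuous_eval_const x }
  map_add' x y := by ext f; exact map_add f x y
  map_smul' c x := by ext f; exact map_smul f c x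

/-- `E` is reflexive: the canonical map into the strong bidual is bijective and a homeomorphism. -/
def IsReflexiveTVS (E : Type*) [AddCommGroup E] [Module ℂ E] [TopologicalSpace E]
    [ContinuousSMul ℂ E] : Prop :=
  IsHomeomorph (strongBidualMap E)

end Reflexive

/-- A strong algebra structure on the dual of a countably normed space: an associative, not
necessarily unital, bilinear multiplication that satisfies the two-sided norm inequalities. -/
structure StrongAlgebra {E : Type*} [AddCommGroup E] [Module ℂ E] [TopologicalSpace E]
    [IsTopologicalAddGroup E] {n : ℕ → Seminorm ℂ E} (hn : IsCountablyNormed n) where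
  /-- The multiplication. -/
  mul : StrongDual ℂ E →ₗ[ℂ] StrongDual ℂ E →ₗ[ℂ] StrongDual ℂ E
  mul_assoc : ∀ a b c : StrongDual ℂ E, mul (mul a b) c = mul a (mul b c)
  /-- There is `d` such that, for `p > q + d`, products in either order of an element `a` of the
  `q`-th dual and an element `b` of the `p`-th dual lie in the `p`-th dual, with the bound
  `A * ‖a‖ * ‖b‖` on their norms there, where `A` depends only on `p` and `q`. -/
  bound : ∃ d : ℕ, ∀ q p : ℕ, q + d < p → ∃ A : ℝ, 0 < A ∧
    ∀ (a : StrongDual ℂ (NormCompletion (n q))) (b : StrongDual ℂ (NormCompletion (n p))),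
      (∃ c : StrongDual ℂ (NormCompletion (n p)),
        hn.dualInclusion p c = mul (hn.dualInclusion q a) (hn.dualInclusion p b) ∧
          ‖c‖ ≤ A * ‖a‖ * ‖b‖) ∧
      (∃ c : StrongDual ℂ (NormCompletion (n p)),
        hn.dualInclusion p c = mul (hn.dualInclusion p b) (hn.dualInclusion q a) ∧
          ‖c‖ ≤ A * ‖a‖ * ‖b‖)

namespace StrongAlgebra

/-- The underlying set of the strong algebra, namely the dual of `E`. -/
def Carrier {E : Type*} [AddCommGroup E] [Module ℂ E] [TopologicalSpace E]
    [IsTopologicalAddGroup E] {n : ℕ → Seminorm ℂ E} {hn : IsCountablyNormed n}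
    (_S : StrongAlgebra hn) : Type _ := StrongDual ℂ E

/-- The topology is the strong topology (uniform convergence on the bounded subsets of `E`). -/
instance instTopologicalSpace {E : Type*} [AddCommGroup E] [Module ℂ E] [TopologicalSpace E]
    [IsTopologicalAddGroup E] {n : ℕ → Seminorm ℂ E} {hn : IsCountablyNormed n}
    (S : StrongAlgebra hn) : TopologicalSpace S.Carrier :=
  inferInstanceAs (TopologicalSpace (StrongDual ℂ E))

instance instAddCommGroup {E : Type*} [AddCommGroup E] [Module ℂ E] [TopologicalSpace E]
    [IsTopologicalAddGroup E] {n : ℕ → Seminorm ℂ E} {hn : IsCountablyNormed n}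
    (S : StrongAlgebra hn) : AddCommGroup S.Carrier :=
  inferInstanceAs (AddCommGroup (StrongDual ℂ E))

/-- The ring structure: addition of functionals, and the multiplication of the strong algebra. -/
instance instNonUnitalRing {E : Type*} [AddCommGroup E] [Module ℂ E] [TopologicalSpace E]
    [IsTopologicalAddGroup E] {n : ℕ → Seminorm ℂ E} {hn : IsCountablyNormed n}
    (S : StrongAlgebra hn) : NonUnitalRing S.Carrier :=
  { instAddCommGroup S with
    mul := fun a b => S.mul a b
    mul_assoc := S.mul_assoc
    left_distrib := fun a b c => map_add (S.mul a) b c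
    right_distrib := fun a b c => LinearMap.map_add₂ S.mul a b c
    zero_mul := fun a => LinearMap.map_zero₂ S.mul a
    mul_zero := fun a => map_zero (S.mul a) }

instance instModule {E : Type*} [AddCommGroup E] [Module ℂ E] [TopologicalSpace E]
    [IsTopologicalAddGroup E] {n : ℕ → Seminorm ℂ E} {hn : IsCountablyNormed n}
    (S : StrongAlgebra hn) : Module ℂ S.Carrier :=
  inferInstanceAs (Module ℂ (StrongDual ℂ E))

/-- The multiplication is `ℂ`-linear in the first variable. -/
instance instIsScalarTower {E : Type*} [AddCommGroup E] [Module ℂ E] [TopologicalSpace E]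
    [IsTopologicalAddGroup E] {n : ℕ → Seminorm ℂ E} {hn : IsCountablyNormed n}
    (S : StrongAlgebra hn) : IsScalarTower ℂ S.Carrier S.Carrier :=
  ⟨fun c a b => LinearMap.map_smul₂ S.mul c a b⟩

/-- The multiplication is `ℂ`-linear in the second variable. -/
instance instSMulCommClass {E : Type*} [AddCommGroup E] [Module ℂ E] [TopologicalSpace E]
    [IsTopologicalAddGroup E] {n : ℕ → Seminorm ℂ E} {hn : IsCountablyNormed n}
    (S : StrongAlgebra hn) : SMulCommClass ℂ S.Carrier S.Carrier :=
  ⟨fun c a b => (map_smul (S.mul a) c b).symm⟩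

end StrongAlgebra

end

open scoped NNReal

noncomputable section

/-! By bilinearity it suffices to treat products near the origin. The crux is that, for every
positive sequence `c`, the functionals bounded by some finite partial sum of `∑ c p * n p` form a
strong neighbourhood of `0` (`dominatedFunctionals_mem_nhds_zero`). Reflexivity enters here:
functionals on the strong dual are evaluations at points, so a bipolar argument places the polar of
a bounded set in the closure of such a set, and taking the closure costs only a factor 2 in the
weights.

By Hahn–Banach, a member of this neighbourhood is a finite sum of pieces, the `p`-th bounded by `c p
* n p`. The product of a `p`-th and a `q`-th piece is controlled by a single norm, with a constant
depending only on `p` and `q`. These pairs are countable, so `c` can decrease fast enough that the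
double sum of all products is at most `ε` on a given bounded set, however many pieces occur. -/

/-! ### Hahn–Banach: splitting and norming functionals -/

theorem Seminorm.exists_dual_add_of_norm_le_add {E : Type*} [AddCommGroup E] [Module ℂ E]
    (f : Module.Dual ℂ E) (s t : Seminorm ℂ E) (h : ∀ x, ‖f x‖ ≤ s x + t x) :
    ∃ g₁ g₂ : Module.Dual ℂ E, f = g₁ + g₂ ∧ (∀ x, ‖g₁ x‖ ≤ s x) ∧ ∀ x, ‖g₂ x‖ ≤ t x := by
  -- Extend `(x, x) ↦ f x` from the diagonal to `E × E` under `s x + t y`; the restrictions of the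
  -- extension to the two factors are the summands.
  let Δ : Submodule ℂ (E × E) := LinearMap.range (LinearMap.id.prod LinearMap.id)
  let N : Seminorm ℂ (E × E) := s.comp (LinearMap.fst ℂ E E) + t.comp (LinearMap.snd ℂ E E)
  obtain ⟨G, hG, hGN⟩ := Module.Dual.exists_extension_of_le_seminorm Δ
    ((f.comp (LinearMap.fst ℂ E E)).comp Δ.subtype) (p := N) (by
      rintro ⟨_, x, rfl⟩
      exact h x)
  refine ⟨G.comp (LinearMap.inl ℂ E E), G.comp (LinearMap.inr ℂ E E), ?_, fun x => ?_,
    fun x => ?_⟩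
  · ext x
    have h1 : G (x, x) = f x := hG ⟨(x, x), x, rfl⟩
    rw [← h1]
    change G (x, x) = G (x, 0) + G (0, x)
    rw [← map_add]
    simp
  · have h1 : ‖G (x, 0)‖ ≤ s x + t 0 := hGN (x, 0)
    rwa [map_zero, add_zero] at h1
  · have h1 : ‖G (0, x)‖ ≤ s 0 + t x := hGN (0, x)
    rwa [map_zero, zero_add] at h1

/-- A functional dominated by a finite sum of seminorms is a sum of functionals dominated by
the individual seminorms. -/
theorem Seminorm.exists_dual_sum_of_norm_le_sum {E : Type*} [AddCommGroup E] [Module ℂ E]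
    (s : ℕ → Seminorm ℂ E) (k : ℕ) (f : Module.Dual ℂ E)
    (h : ∀ x, ‖f x‖ ≤ ∑ i ∈ Finset.range k, s i x) :
    ∃ g : ℕ → Module.Dual ℂ E, f = ∑ i ∈ Finset.range k, g i ∧ ∀ i x, ‖g i x‖ ≤ s i x := by
  induction k generalizing f with
  | zero =>
    refine ⟨0, ?_, fun i x => by simp⟩
    ext x
    simpa using h x
  | succ k ih =>
    have happ : ∀ x, (∑ i ∈ Finset.range k, s i) x = ∑ i ∈ Finset.range k, s i x := fun x =>
      map_sum (⟨⟨fun p : Seminorm ℂ E => p x, rfl⟩, fun _ _ => rfl⟩ : Seminorm ℂ E →+ ℝ) _ _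
    obtain ⟨f₁, f₂, rfl, h₁, h₂⟩ := Seminorm.exists_dual_add_of_norm_le_add f
      (∑ i ∈ Finset.range k, s i) (s k) fun x => by
        rw [happ, ← Finset.sum_range_succ (fun i => s i x)]
        exact h x
    obtain ⟨g, rfl, hg⟩ := ih f₁ fun x => by rw [← happ]; exact h₁ x
    refine ⟨Function.update g k f₂, ?_, fun i => ?_⟩
    · rw [Finset.sum_range_succ, Function.update_self]
      congr 1
      refine Finset.sum_congr rfl fun i hi => ?_
      rw [Function.update_of_ne (Finset.mem_range.1 hi).ne]
    · obtain rfl | hi := eq_or_ne i k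
      · simpa using h₂
      · simpa [hi] using hg i

/-- Every seminorm is attained by a functional that it dominates. -/
theorem Seminorm.exists_dual_apply_eq {E : Type*} [AddCommGroup E] [Module ℂ E]
    (s : Seminorm ℂ E) (y : E) :
    ∃ g : Module.Dual ℂ E, g y = s y ∧ ∀ x, ‖g x‖ ≤ s x := by
  by_cases hy : y = 0
  · exact ⟨0, by simp [hy], by simp⟩
  let e := (LinearEquiv.toSpanNonzeroSingleton ℂ E y hy).symm
  have he : ∀ c : ℂ, e (LinearEquiv.toSpanNonzeroSingleton ℂ E y hy c) = c :=
    LinearEquiv.symm_apply_apply _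
  obtain ⟨g, hg, hgs⟩ := Module.Dual.exists_extension_of_le_seminorm (Submodule.span ℂ {y})
    ((s y : ℂ) • e.toLinearMap) (p := s) (by
      intro x
      obtain ⟨c, rfl⟩ := (LinearEquiv.toSpanNonzeroSingleton ℂ E y hy).surjective x
      change ‖(s y : ℂ) * e _‖ ≤ s (c • y)
      rw [he, norm_mul, Complex.norm_real, Real.norm_of_nonneg (apply_nonneg s y),
        map_smul_eq_mul, mul_comm])
  refine ⟨g, ?_, hgs⟩
  have h1 : g ((1 : ℂ) • y) = (s y : ℂ) * e _ :=
    hg (LinearEquiv.toSpanNonzeroSingleton ℂ E y hy 1)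
  rwa [he, one_smul, mul_one] at h1

theorem Seminorm.exists_strongDual_of_norm_le {E : Type*} [AddCommGroup E] [Module ℂ E]
    [TopologicalSpace E] [IsTopologicalAddGroup E] (f : Module.Dual ℂ E) (s : Seminorm ℂ E)
    (hs : Continuous s) (h : ∀ x, ‖f x‖ ≤ s x) : ∃ g : StrongDual ℂ E, ∀ x, g x = f x := by
  refine ⟨⟨f, continuous_of_continuousAt_zero f ?_⟩, fun _ => rfl⟩
  rw [ContinuousAt, map_zero]
  refine squeeze_zero_norm h ?_
  simpa using hs.tendsto 0

/-! ### Neighbourhoods of zero in the strong dual -/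

/-- The functionals dominated by a finite part of the series `∑ p, c p * n p`. -/
def dominatedFunctionals {E : Type*} [AddCommGroup E] [Module ℂ E] [TopologicalSpace E]
    (n : ℕ → Seminorm ℂ E) (c : ℕ → ℝ) : Set (StrongDual ℂ E) :=
  {f | ∃ k, ∀ x, ‖f x‖ ≤ ∑ p ∈ Finset.range k, c p * n p x}

theorem convex_dominatedFunctionals {E : Type*} [AddCommGroup E] [Module ℂ E]
    [TopologicalSpace E] (n : ℕ → Seminorm ℂ E) {c : ℕ → ℝ} (hc : ∀ p, 0 < c p) :
    Convex ℝ (dominatedFunctionals n c) := by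
  have mono : ∀ (k l : ℕ) (x : E), k ≤ l →
      ∑ p ∈ Finset.range k, c p * n p x ≤ ∑ p ∈ Finset.range l, c p * n p x := fun k l x hkl =>
    Finset.sum_le_sum_of_subset_of_nonneg (Finset.range_mono hkl) fun p _ _ =>
      mul_nonneg (hc p).le (apply_nonneg _ _)
  rintro f ⟨k, hf⟩ g ⟨l, hg⟩ a b ha hb hab
  refine ⟨max k l, fun x => ?_⟩
  have h1 := (hf x).trans (mono k (max k l) x (le_max_left _ _))
  have h2 := (hg x).trans (mono l (max k l) x (le_max_right _ _))
  calc ‖a • f x + b • g x‖ ≤ a * ‖f x‖ + b * ‖g x‖ := by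
        refine (norm_add_le _ _).trans_eq ?_
        rw [norm_smul, norm_smul, Real.norm_of_nonneg ha, Real.norm_of_nonneg hb]
    _ ≤ a * (∑ p ∈ Finset.range (max k l), c p * n p x)
        + b * (∑ p ∈ Finset.range (max k l), c p * n p x) := by gcongr
    _ = _ := by rw [← add_mul, hab, one_mul]

theorem setOf_norm_le_mem_nhds_zero {E : Type*} [AddCommGroup E] [Module ℂ E]
    [TopologicalSpace E] {s : Set E} (hs : Bornology.IsVonNBounded ℂ s) {r : ℝ} (hr : 0 < r) :
    {f : StrongDual ℂ E | ∀ x ∈ s, ‖f x‖ ≤ r} ∈ 𝓝 (0 : StrongDual ℂ E) := by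
  filter_upwards [ContinuousLinearMap.hasBasis_nhds_zero.mem_of_mem
    (i := (s, Metric.closedBall (0 : ℂ) r)) ⟨hs, Metric.closedBall_mem_nhds _ hr⟩] with f hf x hx
  simpa using hf x hx

/-- If no partial sum of the doubled series bounds `f`, there are `y k` with `f (y k) = 1` at which
the `k`-th doubled partial sum is below 1. Each norm is eventually bounded along `y`, so `y` is a
bounded sequence and some dominated `g` is within 1/2 of `f` on it. If the `k`-th partial sum bounds
`g`, then `‖g (y k)‖ < 1/2`, a contradiction. -/
theorem closure_dominatedFunctionals_subset {E : Type*} [AddCommGroup E] [Module ℂ E]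
    [TopologicalSpace E] [IsTopologicalAddGroup E] [ContinuousSMul ℂ E]
    {n : ℕ → Seminorm ℂ E} (hn : WithSeminorms n) {c : ℕ → ℝ} (hc : ∀ p, 0 < c p) :
    closure (dominatedFunctionals n c) ⊆ dominatedFunctionals n (fun p => 2 * c p) := by
  intro f hf
  by_contra hcon
  have hcon' : ∀ k, ∃ x, f x = 1 ∧ ∑ p ∈ Finset.range k, 2 * c p * n p x < 1 := by
    intro k
    obtain ⟨x, hx⟩ : ∃ x, ∑ p ∈ Finset.range k, 2 * c p * n p x < ‖f x‖ := by
      by_contra! h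
      exact hcon ⟨k, h⟩
    have h0 : 0 < ‖f x‖ := (Finset.sum_nonneg fun p _ =>
      mul_nonneg (mul_nonneg zero_le_two (hc p).le) (apply_nonneg _ _)).trans_lt hx
    refine ⟨(f x)⁻¹ • x, ?_, ?_⟩
    · rw [map_smul, smul_eq_mul, inv_mul_cancel₀ (norm_pos_iff.1 h0)]
    · calc ∑ p ∈ Finset.range k, 2 * c p * n p ((f x)⁻¹ • x)
          = ‖f x‖⁻¹ * ∑ p ∈ Finset.range k, 2 * c p * n p x := by
            rw [Finset.mul_sum]
            refine Finset.sum_congr rfl fun p _ => ?_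
            rw [map_smul_eq_mul, norm_inv]
            ring
        _ < ‖f x‖⁻¹ * ‖f x‖ := by gcongr
        _ = 1 := inv_mul_cancel₀ h0.ne'
  choose y hy1 hy using hcon'
  have hterm : ∀ k p, p < k → 2 * c p * n p (y k) < 1 := fun k p hpk =>
    (Finset.single_le_sum (f := fun p => 2 * c p * n p (y k)) (fun i _ =>
      mul_nonneg (mul_nonneg zero_le_two (hc i).le) (apply_nonneg _ _))
      (Finset.mem_range.2 hpk)).trans_lt (hy k)
  have hbdd : Bornology.IsVonNBounded ℂ (Set.range y) := by
    rw [hn.isVonNBounded_iff_seminorm_bddAbove]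
    intro p
    rw [← Set.range_comp]
    have hev : ∀ᶠ k in atTop, (n p ∘ y) k ≤ (2 * c p)⁻¹ := by
      filter_upwards [eventually_gt_atTop p] with k hk
      rw [← one_div, le_div_iff₀' (mul_pos two_pos (hc p))]
      exact (hterm k p hk).le
    have : IsBoundedUnder (· ≤ ·) atTop (n p ∘ y) := ⟨_, hev⟩
    exact this.bddAbove_range
  have hnhds := setOf_norm_le_mem_nhds_zero hbdd (r := 1 / 2) (by norm_num)
  have hnhds' : {g : StrongDual ℂ E | g - f ∈ {h : StrongDual ℂ E | ∀ x ∈ Set.range y,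
      ‖h x‖ ≤ 1 / 2}} ∈ 𝓝 f := by
    have : Tendsto (fun g : StrongDual ℂ E => g - f) (𝓝 f) (𝓝 0) := by
      rw [← sub_self f]
      exact (continuous_id.sub continuous_const).tendsto f
    exact this hnhds
  obtain ⟨g, hg, k, hgk⟩ := mem_closure_iff_nhds.1 hf _ hnhds'
  have h1 : ‖g (y k) - f (y k)‖ ≤ 1 / 2 := hg (y k) ⟨k, rfl⟩
  have h2 : 2 * ‖g (y k)‖ < 1 := by
    refine lt_of_le_of_lt ?_ (hy k)
    calc 2 * ‖g (y k)‖ ≤ 2 * ∑ p ∈ Finset.range k, c p * n p (y k) := by gcongr; exact hgk _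
      _ = _ := by rw [Finset.mul_sum]; exact Finset.sum_congr rfl fun p _ => by ring
  have h3 : ‖f (y k)‖ ≤ ‖g (y k)‖ + ‖g (y k) - f (y k)‖ := by
    have := norm_sub_le (g (y k)) (g (y k) - f (y k))
    rwa [sub_sub_cancel] at this
  have h4 : ‖f (y k)‖ = 1 := by rw [hy1, norm_one]
  linarith

/-- Bipolar argument: a functional separating `f` from the closed convex set is evaluation at some
`y`, by reflexivity. Testing it on functionals that norm `y` shows that `y`, rescaled by the
separating level `u`, satisfies the constraints in `hf`, which contradicts the separation. -/
theorem mem_closure_dominatedFunctionals {E : Type*} [AddCommGroup E] [Module ℂ E]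
    [TopologicalSpace E] [IsTopologicalAddGroup E] [ContinuousSMul ℂ E]
    {n : ℕ → Seminorm ℂ E} (hn : WithSeminorms n)
    (hE : Function.Surjective (strongBidualMap E)) {c : ℕ → ℝ} (hc : ∀ p, 0 < c p)
    {f : StrongDual ℂ E} (hf : ∀ y, (∀ p, c p * n p y ≤ 1) → ‖f y‖ ≤ 1) :
    f ∈ closure (dominatedFunctionals n c) := by
  by_contra hcl
  obtain ⟨φ, u, hφ, hu⟩ := RCLike.geometric_hahn_banach_closed_point (𝕜 := ℂ)
    (convex_dominatedFunctionals n hc).closure isClosed_closure hcl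
  obtain ⟨y, rfl⟩ := hE φ
  replace hφ : ∀ g ∈ dominatedFunctionals n c, (g y).re < u := fun g hg =>
    hφ g (subset_closure hg)
  replace hu : u < (f y).re := hu
  have hu0 : 0 < u := by
    simpa using hφ 0 ⟨0, by simp⟩
  have hy : ∀ p, c p * n p ((u⁻¹ : ℂ) • y) ≤ 1 := by
    intro p
    let a : ℝ≥0 := ⟨c p, (hc p).le⟩
    let s : Seminorm ℂ E := a • n p
    obtain ⟨g, hgy, hgs⟩ := Seminorm.exists_dual_apply_eq s y
    obtain ⟨g', hg'⟩ := Seminorm.exists_strongDual_of_norm_le g s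
      ((hn.continuous_seminorm p).const_smul a) hgs
    have hmem : g' ∈ dominatedFunctionals n c := by
      refine ⟨p + 1, fun x => ?_⟩
      rw [hg']
      exact (hgs x).trans (Finset.single_le_sum (f := fun p => c p * n p x) (fun i _ =>
        mul_nonneg (hc i).le (apply_nonneg _ _)) (Finset.self_mem_range_succ p))
    have h1 := hφ g' hmem
    rw [hg', hgy, Complex.ofReal_re] at h1
    replace h1 : c p * n p y < u := h1
    rw [map_smul_eq_mul, norm_inv, Complex.norm_real, Real.norm_of_nonneg hu0.le,
      mul_left_comm, inv_mul_le_one₀ hu0]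
    exact h1.le
  have h1 := hf _ hy
  rw [map_smul, norm_smul, norm_inv, Complex.norm_real, Real.norm_of_nonneg hu0.le,
    inv_mul_le_one₀ hu0] at h1
  exact absurd (hu.trans_le ((Complex.re_le_norm _).trans h1)) (lt_irrefl u)

/-- The strong dual of a reflexive countably normed space is a countable inductive limit of normed
spaces: the functionals dominated by finite parts of a positive series form a neighbourhood
of `0`. -/
theorem dominatedFunctionals_mem_nhds_zero {E : Type*} [AddCommGroup E] [Module ℂ E]
    [TopologicalSpace E] [IsTopologicalAddGroup E] [ContinuousSMul ℂ E]
    {n : ℕ → Seminorm ℂ E} (hn : WithSeminorms n)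
    (hE : Function.Surjective (strongBidualMap E)) {c : ℕ → ℝ} (hc : ∀ p, 0 < c p) :
    dominatedFunctionals n c ∈ 𝓝 (0 : StrongDual ℂ E) := by
  -- The weights are halved because passing to the closure doubles them.
  have hc2 : ∀ p, 0 < c p / 2 := fun p => half_pos (hc p)
  have hbdd : Bornology.IsVonNBounded ℂ {y : E | ∀ p, c p / 2 * n p y ≤ 1} := by
    rw [hn.isVonNBounded_iff_seminorm_bddAbove]
    refine fun p => ⟨(c p / 2)⁻¹, ?_⟩
    rintro _ ⟨y, hy, rfl⟩
    rw [← one_div, le_div_iff₀' (hc2 p)]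
    exact hy p
  filter_upwards [setOf_norm_le_mem_nhds_zero hbdd one_pos] with f hf
  have h1 := closure_dominatedFunctionals_subset hn hc2
    (mem_closure_dominatedFunctionals hn hE hc2 hf)
  simpa only [mul_div_cancel₀ _ (two_ne_zero' ℝ)] using h1

/-! ### Weights, completions and decompositions -/

/-- The weight with the larger index absorbs the constant: `T p` dominates `D p q` and `D q p` for
all `q ≤ p`, and `c p = 4 ^ (-(p + 1)) / T p`. The other weight is at most 1, and `4 ^ (-(p + 1))`
splits into two powers of 1/2. -/
theorem exists_pos_weights (D : ℕ → ℕ → ℝ) (hD : ∀ p q, 0 ≤ D p q) :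
    ∃ c : ℕ → ℝ, (∀ p, 0 < c p) ∧
      ∀ p q, D p q * c p * c q ≤ (1 / 2) ^ (p + 1) * (1 / 2) ^ (q + 1) := by
  let T : ℕ → ℝ := fun p => 1 + ∑ q ∈ Finset.range (p + 1), (D p q + D q p)
  have hsum : ∀ p, 0 ≤ ∑ q ∈ Finset.range (p + 1), (D p q + D q p) := fun p =>
    Finset.sum_nonneg fun q _ => add_nonneg (hD _ _) (hD _ _)
  have hT : ∀ p, 1 ≤ T p := fun p => le_add_of_nonneg_right (hsum p)
  have hT0 : ∀ p, 0 < T p := fun p => one_pos.trans_le (hT p)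
  have hDT : ∀ p q, q ≤ p → D p q + D q p ≤ T p := fun p q h =>
    (Finset.single_le_sum (f := fun q => D p q + D q p)
      (fun q _ => add_nonneg (hD _ _) (hD _ _)) (Finset.mem_range_succ_iff.2 h)).trans
      (le_add_of_nonneg_left zero_le_one)
  let c : ℕ → ℝ := fun p => (1 / 4) ^ (p + 1) / T p
  have hc : ∀ p, 0 < c p := fun p => div_pos (by positivity) (hT0 p)
  have hc1 : ∀ p, c p ≤ 1 := fun p =>
    div_le_one_of_le₀ ((pow_le_one₀ (by norm_num) (by norm_num)).trans (hT p)) (hT0 p).le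
  have key : ∀ p q, q ≤ p → ∀ d, 0 ≤ d → d ≤ T p →
      d * c p * c q ≤ (1 / 2) ^ (p + 1) * (1 / 2) ^ (q + 1) := by
    intro p q hqp d hd0 hd
    calc d * c p * c q ≤ T p * c p * 1 := by
          have := hc p
          have := hT0 p
          have := hc1 q
          have := (hc q).le
          gcongr
      _ = (1 / 2) ^ (p + 1) * (1 / 2) ^ (p + 1) := by
          rw [mul_one, mul_div_cancel₀ _ (hT0 p).ne', ← mul_pow]
          norm_num
      _ ≤ _ := by
          gcongr ?_ * ?_
          exact pow_le_pow_of_le_one (by norm_num) (by norm_num) (by omega)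
  refine ⟨c, hc, fun p q => ?_⟩
  obtain h | h := le_total q p
  · exact key p q h _ (hD p q) ((le_add_of_nonneg_right (hD q p)).trans (hDT p q h))
  · have := key q p h _ (hD p q) ((le_add_of_nonneg_left (hD q p)).trans (hDT q p h))
    rwa [mul_right_comm, mul_comm ((1 / 2 : ℝ) ^ (p + 1))]

/-- Extension by density from `E` to its completion preserves the bound. This turns pointwise
estimates on `E` into membership in the `p`-th dual, where the strong algebra inequality applies. -/
theorem IsCountablyNormed.exists_dualInclusion_eq {E : Type*} [AddCommGroup E] [Module ℂ E]
    [TopologicalSpace E] [IsTopologicalAddGroup E] {n : ℕ → Seminorm ℂ E}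
    (hn : IsCountablyNormed n) (p : ℕ) (f : StrongDual ℂ E) {a : ℝ} (ha : 0 ≤ a)
    (h : ∀ x, ‖f x‖ ≤ a * n p x) :
    ∃ f' : StrongDual ℂ (NormCompletion (n p)), hn.dualInclusion p f' = f ∧ ‖f'‖ ≤ a := by
  let f₁ : Renormed (n p) →ₗ[ℂ] ℂ := f.toLinearMap
  let f₀ : StrongDual ℂ (Renormed (n p)) := f₁.mkContinuous a h
  have hf₀ : ‖f₀‖ ≤ a := f₁.mkContinuous_norm_le ha h
  let F := f₀.extend (UniformSpace.Completion.toComplL (E := Renormed (n p)) (𝕜 := ℂ))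
  have hF : ∀ x : Renormed (n p), F (x : NormCompletion (n p)) = f₀ x := fun x =>
    ContinuousLinearMap.extend_eq f₀
      (UniformSpace.Completion.denseRange_coe)
      (UniformSpace.Completion.isUniformInducing_coe _) x
  refine ⟨F, ?_, ContinuousLinearMap.opNorm_le_bound _ ha fun z => ?_⟩
  · ext x
    exact hF x
  · induction z using UniformSpace.Completion.induction_on with
    | hp => exact isClosed_le F.continuous.norm (continuous_const.mul continuous_norm)
    | ih x =>
      rw [hF, UniformSpace.Completion.norm_coe]
      exact h x

theorem IsCountablyNormed.norm_dualInclusion_apply_le {E : Type*} [AddCommGroup E] [Module ℂ E]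
    [TopologicalSpace E] [IsTopologicalAddGroup E] {n : ℕ → Seminorm ℂ E}
    (hn : IsCountablyNormed n) (p : ℕ) (f : StrongDual ℂ (NormCompletion (n p))) (x : E) :
    ‖hn.dualInclusion p f x‖ ≤ ‖f‖ * n p x := by
  rw [← norm_toNormCompletion (n p) x]
  exact f.le_opNorm _

/-- A functional in `dominatedFunctionals n c` is a finite sum of functionals dominated by
the terms of the series. -/
theorem exists_sum_eq_of_mem_dominatedFunctionals {E : Type*} [AddCommGroup E]
    [Module ℂ E] [TopologicalSpace E] [IsTopologicalAddGroup E] [ContinuousSMul ℂ E]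
    {n : ℕ → Seminorm ℂ E} (hn : WithSeminorms n) {c : ℕ → ℝ} (hc : ∀ p, 0 < c p)
    {f : StrongDual ℂ E} (hf : f ∈ dominatedFunctionals n c) :
    ∃ (k : ℕ) (g : ℕ → StrongDual ℂ E), f = ∑ p ∈ Finset.range k, g p ∧
      ∀ p x, ‖g p x‖ ≤ c p * n p x := by
  obtain ⟨k, hk⟩ := hf
  let a : ℕ → ℝ≥0 := fun p => ⟨c p, (hc p).le⟩
  -- The pieces are at first only algebraic; domination by a continuous seminorm makes them
  -- continuous.
  obtain ⟨g, hg, hgn⟩ := Seminorm.exists_dual_sum_of_norm_le_sum (fun p => a p • n p) k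
    f.toLinearMap hk
  have hg' := fun p => Seminorm.exists_strongDual_of_norm_le (g p) (a p • n p)
    ((hn.continuous_seminorm p).const_smul (a p)) (hgn p)
  choose g' hg' using hg'
  refine ⟨k, g', ?_, fun p x => by rw [hg']; exact hgn p x⟩
  ext x
  have h1 : f x = (∑ p ∈ Finset.range k, g p) x := LinearMap.congr_fun hg x
  rw [h1, LinearMap.sum_apply, _root_.sum_apply]
  exact Finset.sum_congr rfl fun p _ => (hg' p x).symm

theorem sum_half_pow_le_one (k : ℕ) :
    ∑ p ∈ Finset.range k, (1 / 2 : ℝ) ^ (p + 1) ≤ 1 := by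
  have h : ∑ p ∈ Finset.range k, (1 / 2 : ℝ) ^ (p + 1) = 1 - (1 / 2) ^ k := by
    induction k with
    | zero => simp
    | succ k ih => rw [Finset.sum_range_succ, ih, pow_succ]; ring
  rw [h]
  exact sub_le_self _ (by positivity)

/-! ### Continuity of the multiplication at the origin -/

namespace StrongAlgebra

theorem exists_norm_mul_apply_le {E : Type*} [AddCommGroup E] [Module ℂ E]
    [TopologicalSpace E] [IsTopologicalAddGroup E] {n : ℕ → Seminorm ℂ E}
    {hn : IsCountablyNormed n} (S : StrongAlgebra hn) (p q : ℕ) :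
    ∃ (r : ℕ) (A : ℝ), 0 < A ∧ ∀ (f g : StrongDual ℂ E) (a b : ℝ), 0 ≤ a → 0 ≤ b →
      (∀ x, ‖f x‖ ≤ a * n p x) → (∀ x, ‖g x‖ ≤ b * n q x) →
      ∀ x, ‖S.mul f g x‖ ≤ A * a * b * n r x := by
  obtain ⟨d, hd⟩ := S.bound
  -- Above `p + d`, so that the inequality applies, and above `q`, so that monotonicity puts `g` in
  -- the `r`-th dual.
  let r := max p q + d + 1
  obtain ⟨A, hA, hmul⟩ := hd p r (by omega)
  refine ⟨r, A, hA, fun f g a b ha hb hf hg x => ?_⟩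
  obtain ⟨f', rfl, hf'⟩ := hn.exists_dualInclusion_eq p f ha hf
  obtain ⟨g', rfl, hg'⟩ := hn.exists_dualInclusion_eq r g hb fun y =>
    (hg y).trans (mul_le_mul_of_nonneg_left (hn.mono q r (by omega) y) hb)
  obtain ⟨c, hc, hcn⟩ := (hmul f' g').1
  rw [← hc]
  refine (hn.norm_dualInclusion_apply_le r c x).trans
    (mul_le_mul_of_nonneg_right (hcn.trans ?_) (apply_nonneg _ _))
  gcongr

/-- Every polar of a bounded set contains the products of the elements of a neighbourhood
of `0`. -/
theorem exists_nhds_norm_mul_apply_le {E : Type*} [AddCommGroup E] [Module ℂ E]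
    [TopologicalSpace E] [IsTopologicalAddGroup E] [ContinuousSMul ℂ E] {n : ℕ → Seminorm ℂ E}
    {hn : IsCountablyNormed n} (hE : Function.Surjective (strongBidualMap E))
    (S : StrongAlgebra hn) {s : Set E} (hs : Bornology.IsVonNBounded ℂ s) {ε : ℝ} (hε : 0 < ε) :
    ∃ V ∈ 𝓝 (0 : StrongDual ℂ E), ∀ f ∈ V, ∀ g ∈ V, ∀ x ∈ s, ‖S.mul f g x‖ ≤ ε := by
  choose r A hA hmul using S.exists_norm_mul_apply_le
  choose R hR hsR using hn.withSeminorms.isVonNBounded_iff_seminorm_bounded.1 hs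
  -- `R (r p q)` bounds the norm `n (r p q)` on `s`. The weights are fixed before `f` and `g`, so
  -- the final bound does not depend on the numbers of pieces `k` and `l`.
  obtain ⟨c, hc, hcD⟩ := exists_pos_weights (fun p q => A p q * R (r p q) / ε) fun p q =>
    div_nonneg (mul_nonneg (hA p q).le (hR _).le) hε.le
  refine ⟨dominatedFunctionals n c,
    dominatedFunctionals_mem_nhds_zero hn.withSeminorms hE hc, fun f hf g hg x hx => ?_⟩
  obtain ⟨k, u, rfl, hu⟩ := exists_sum_eq_of_mem_dominatedFunctionals hn.withSeminorms hc hf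
  obtain ⟨l, v, rfl, hv⟩ := exists_sum_eq_of_mem_dominatedFunctionals hn.withSeminorms hc hg
  have hterm : ∀ p q, ‖S.mul (u p) (v q) x‖ ≤ ε * ((1 / 2) ^ (p + 1) * (1 / 2) ^ (q + 1)) := by
    intro p q
    calc ‖S.mul (u p) (v q) x‖ ≤ A p q * c p * c q * n (r p q) x :=
          hmul p q _ _ _ _ (hc p).le (hc q).le (hu p) (hv q) x
      _ ≤ A p q * c p * c q * R (r p q) :=
          mul_le_mul_of_nonneg_left (hsR _ x hx).le
            (mul_nonneg (mul_nonneg (hA p q).le (hc p).le) (hc q).le)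
      _ = ε * (A p q * R (r p q) / ε * c p * c q) := by
          field_simp
      _ ≤ _ := mul_le_mul_of_nonneg_left (hcD p q) hε.le
  simp only [map_sum, LinearMap.sum_apply, _root_.sum_apply]
  calc _ ≤ ∑ p ∈ Finset.range k, ∑ q ∈ Finset.range l,
        ε * ((1 / 2) ^ (p + 1) * (1 / 2) ^ (q + 1)) := by
        rw [Finset.sum_comm]
        exact norm_sum_le_of_le _ fun q _ => norm_sum_le_of_le _ fun p _ => hterm _ _
    _ = ε * ((∑ p ∈ Finset.range k, (1 / 2) ^ (p + 1))
          * ∑ q ∈ Finset.range l, (1 / 2) ^ (q + 1)) := by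
        rw [Finset.sum_mul_sum, Finset.mul_sum]
        exact Finset.sum_congr rfl fun p _ => by rw [Finset.mul_sum]
    _ ≤ ε * 1 := mul_le_mul_of_nonneg_left (mul_le_one₀ (sum_half_pow_le_one k)
        (Finset.sum_nonneg fun _ _ => by positivity) (sum_half_pow_le_one l)) hε.le
    _ = ε := mul_one ε

instance {E : Type*} [AddCommGroup E] [Module ℂ E] [TopologicalSpace E]
    [IsTopologicalAddGroup E] {n : ℕ → Seminorm ℂ E} {hn : IsCountablyNormed n}
    (S : StrongAlgebra hn) : IsTopologicalAddGroup S.Carrier :=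
  inferInstanceAs (IsTopologicalAddGroup (StrongDual ℂ E))

instance {E : Type*} [AddCommGroup E] [Module ℂ E] [TopologicalSpace E]
    [IsTopologicalAddGroup E] [ContinuousSMul ℂ E] {n : ℕ → Seminorm ℂ E}
    {hn : IsCountablyNormed n} (S : StrongAlgebra hn) : ContinuousSMul ℂ S.Carrier :=
  inferInstanceAs (ContinuousSMul ℂ (StrongDual ℂ E))

theorem exists_nhds_mul_mem {E : Type*} [AddCommGroup E] [Module ℂ E]
    [TopologicalSpace E] [IsTopologicalAddGroup E] [ContinuousSMul ℂ E] {n : ℕ → Seminorm ℂ E}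
    {hn : IsCountablyNormed n} (hE : Function.Surjective (strongBidualMap E))
    (S : StrongAlgebra hn) {W : Set S.Carrier} (hW : W ∈ 𝓝 0) :
    ∃ V ∈ 𝓝 (0 : S.Carrier), ∀ f ∈ V, ∀ g ∈ V, f * g ∈ W := by
  obtain ⟨⟨s, ε⟩, ⟨hs, hε⟩, hsW⟩ := (ContinuousLinearMap.hasBasis_nhds_zero_of_basis
    (σ := RingHom.id ℂ) (E := E) (Metric.nhds_basis_closedBall (x := (0 : ℂ)))).mem_iff.1 hW
  obtain ⟨V, hV, hVW⟩ := S.exists_nhds_norm_mul_apply_le hE hs hε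
  exact ⟨V, hV, fun f hf g hg => hsW fun x hx => mem_closedBall_zero_iff.2 (hVW f hf g hg x hx)⟩

end StrongAlgebra

/-! ### From the origin to joint continuity -/

/-- In a topological module with a bilinear multiplication, it is enough to check continuity
of the multiplication at the origin. -/
theorem IsTopologicalRing.of_exists_nhds_mul_mem {A : Type*} [NonUnitalRing A] [Module ℂ A]
    [IsScalarTower ℂ A A] [SMulCommClass ℂ A A] [TopologicalSpace A] [IsTopologicalAddGroup A]
    [ContinuousSMul ℂ A]
    (h : ∀ W ∈ 𝓝 (0 : A), ∃ V ∈ 𝓝 (0 : A), ∀ f ∈ V, ∀ g ∈ V, f * g ∈ W) :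
    IsTopologicalRing A := by
  have habs : ∀ V ∈ 𝓝 (0 : A), ∀ a : A, ∃ t : ℂ, t ≠ 0 ∧ t • a ∈ V := by
    intro V hV a
    have h0 : Tendsto (fun t : ℂ => t • a) (𝓝[≠] 0) (𝓝 0) := by
      have : Tendsto (fun t : ℂ => t • a) (𝓝 0) (𝓝 ((0 : ℂ) • a)) :=
        (continuous_id.smul continuous_const).tendsto 0
      rw [zero_smul] at this
      exact this.mono_left nhdsWithin_le_nhds
    obtain ⟨t, ht, ht0⟩ := ((h0.eventually hV).and self_mem_nhdsWithin).exists
    exact ⟨t, ht0, ht⟩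
  have hscale : ∀ V ∈ 𝓝 (0 : A), ∀ t : ℂ, ∀ᶠ x in 𝓝 (0 : A), t • x ∈ V := by
    intro V hV t
    have : Tendsto (fun x : A => t • x) (𝓝 0) (𝓝 0) := by
      simpa using (continuous_const_smul t).tendsto (0 : A)
    exact this.eventually hV
  -- Besides continuity at the origin, one needs `x ↦ a * x` and `x ↦ x * a` to be continuous at
  -- `0`. Both follow by moving a scalar across the product, as in `a * x = (t • a) * (t⁻¹ • x)`,
  -- with `t ≠ 0` chosen so that `t • a ∈ V`.
  refine IsTopologicalRing.of_addGroup_of_nhds_zero (fun W hW => ?_) (fun a W hW => ?_)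
    fun a W hW => ?_
  · obtain ⟨V, hV, hVW⟩ := h W hW
    rw [mem_map]
    filter_upwards [prod_mem_prod hV hV] with x hx using hVW _ hx.1 _ hx.2
  · obtain ⟨V, hV, hVW⟩ := h W hW
    obtain ⟨t, ht, hta⟩ := habs V hV a
    rw [mem_map]
    filter_upwards [hscale V hV t⁻¹] with x hx
    have := hVW _ hta _ hx
    rwa [smul_mul_smul_comm, mul_inv_cancel₀ ht, one_smul] at this
  · obtain ⟨V, hV, hVW⟩ := h W hW
    obtain ⟨t, ht, hta⟩ := habs V hV a
    rw [mem_map]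
    filter_upwards [hscale V hV t⁻¹] with x hx
    have := hVW _ hx _ hta
    rwa [smul_mul_smul_comm, inv_mul_cancel₀ ht, one_smul] at this
end

/-- In a strong algebra the multiplication is jointly continuous for the strong topology, and
the strong algebra is a topological `ℂ`-algebra. -/
theorem theorem2p2 {E : Type*} [AddCommGroup E] [Module ℂ E] [UniformSpace E]
    [IsUniformAddGroup E] [ContinuousSMul ℂ E] [CompleteSpace E]
    {n : ℕ → Seminorm ℂ E} (hn : IsCountablyNormed n) (hE : IsReflexiveTVS E)
    (S : StrongAlgebra hn) :
    Continuous (fun x : S.Carrier × S.Carrier => x.1 * x.2) ∧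
      IsTopologicalRing S.Carrier ∧ ContinuousSMul ℂ S.Carrier := by
  have h : IsTopologicalRing S.Carrier := IsTopologicalRing.of_exists_nhds_mul_mem fun _ hW =>
    S.exists_nhds_mul_mem hE.surjective hW
  exact ⟨continuous_mul, h, inferInstance⟩
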